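/- **Setting.** A *layered contextual MDP* (CMDP) with horizon $H$ consists of a finite context space $\mathcal C\subset\mathbb R^{d}$, finite sets $S$ of states and $A$ of actions, a distribution $\mathcal D$ on $\mathcal C$ and, for each context $c$, transition probabilities $P^c(\cdot\mid s,a)$ and reward distributions $R^c(s,a)$ on $[0,1]$ with means $r^c(s,a)$. The state space is partitioned into layers $S_0=\{s_0\},S_1,\dots,S_H=\{s_H\}$, transitions lead only from a layer to the next one, and the final state $s_H$ has reward $0$. The dynamics is *context-independent* if $P^c=P$ for all $c$. The value of a policy $\pi:S\to\Delta(A)$ is $V^{\pi}_c=\mathbb E\big[\sum_{h=0}^{H-1}r^c(s_h,a_h)\big]$, where $s_0,a_0,\dots,s_{H-1},a_{H-1}$ is generated by $\pi$ and $P^c$, and $V^\star_c=\max_\pi V^\pi_c$. In each episode $t=1,\dots,T$ a context $c_t\sim\mathcal D$ is drawn independently, a (possibly randomized) algorithm chooses a policy $\pi_t$ from $c_t$ and the past episodes, and it then observes the trajectory (states, actions and rewards) of $\pi_t$ under $c_t$. The expected regret is $\mathbb E\big[\sum_{t=1}^T (V^\star_{c_t}-V^{\pi_t}_{c_t})\big]$.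 A class $\mathcal G\subseteq(\mathcal C\times A\to[0,1])$ is *realizable* (for $\mathcal F=\mathcal G^S$) if for every $s\ne s_H$ there is $g_s\in\mathcal G$ with $r^c(s,a)=g_s(c,a)$ for all $c,a$. **Theorem (lower bound for CMDP).** There is an absolute constant $\kappa>0$ such that the following holds. Let $\delta\in(0,1)$, $H\ge 2$, $M\ge 1$, let $A$ be a finite set with $|A|\ge 2$, let $N\ge|A|$, let $S$ be a finite set with $|S|=M(H-1)+2$, and let $$T\ \ge\ 8M\ln\frac{|S|}{\delta}+2M\,\frac{\ln N}{\ln|A|}.$$ Then there are a finite context space $\mathcal C$ and context-independent layered dynamics $P$ on $S$ with horizon $H$, for which every policy visits every state with probability at least some $p_{\min}>0$, such that for every algorithm, which may know $T$, $\mathcal C$, $P$ and the class $\mathcal G$, there exist a class $\mathcal G\subseteq(\mathcal C\times A\to[0,1])$ with $|\mathcal G|\le N$ and a CMDP with dynamics $P$, for which $\mathcal G$ is realizable, on which the expected regret of the algorithm over $T$ episodes is at least $$\kappa\cdot\min\Big\{\sqrt{T\,H\,|S|\,|A|\,\frac{\ln N}{\ln|A|}},\ T H\Big\}.$$ -/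

import Mathlib

namespace CtxMDP

noncomputable section

/-- Expectation of a real function under a discrete distribution. It is only applied to bounded
functions, for which the series converges absolutely. -/
def expect {X : Type*} (p : PMF X) (f : X → ℝ) : ℝ :=
  ∑' x, (p x).toReal * f x

/-- A stochastic policy `S → Δ(A)`. -/
abbrev Policy (S A : Type*) := S → PMF A

/-- A trajectory `(s₀, a₀, r₀, …, s_{H-1}, a_{H-1}, r_{H-1}, s_H)`: the list of the
state-action-reward triples, and the last state. Rewards lie in `[0,1]`. -/
structure Trajectory (S A : Type*) where
  steps : List (S × A × unitInterval)
  last : S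

/-- Law of the trajectory of length `n` from the state `s`, for transitions `P`, reward laws `R`
and policy `π`. -/
def rollout {S A : Type*} (P : S → A → PMF S) (R : S → A → PMF unitInterval) (π : Policy S A) :
    ℕ → S → PMF (Trajectory S A)
  | 0, s => PMF.pure ⟨[], s⟩
  | n + 1, s =>
      (π s).bind fun a => (R s a).bind fun r => (P s a).bind fun s' =>
        (rollout P R π n s').map fun τ => ⟨(s, a, r) :: τ.steps, τ.last⟩

/-- Law of the state at time `h` of an episode which starts at `s`. -/
def stateLaw {S A : Type*} (P : S → A → PMF S) (π : Policy S A) (s : S) : ℕ → PMF S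
  | 0 => PMF.pure s
  | h + 1 => (stateLaw P π s h).bind fun x => (π x).bind fun a => P x a

/-- Layered (loop-free) dynamics with horizon `H`: the state space is partitioned into the layers
`S_h = {s | layer s = h}`, `h = 0, …, H`, with a unique start state `S_0 = {start}` and a unique
final state `S_H = {final}`, and transitions are possible only from a layer to the next one.
(An episode ends on reaching `final`, so the transitions out of `final` are irrelevant.) -/
structure LayeredDynamics (S A : Type*) (H : ℕ) where
  trans : S → A → PMF S
  start : S
  final : S
  layer : S → ℕ
  layer_le : ∀ s, layer s ≤ H
  layer_eq_zero_iff : ∀ s, layer s = 0 ↔ s = start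
  layer_eq_horizon_iff : ∀ s, layer s = H ↔ s = final
  layer_succ : ∀ s a s', s ≠ final → s' ∈ (trans s a).support → layer s' = layer s + 1

/-- Minimum reachability: every policy visits every state with probability at least `p`. -/
def LayeredDynamics.MinReachable {S A : Type*} {H : ℕ} (P : LayeredDynamics S A H) (p : ℝ) : Prop :=
  ∀ (π : Policy S A) (s : S), p ≤ (stateLaw P.trans π P.start (P.layer s) s).toReal

/-- A stochastic contextual MDP: each context `c` determines layered dynamics and reward laws
`R^c(s,a)` on `[0,1]`, and contexts are drawn from `ctxLaw`. The final state has reward `0`. -/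
structure CMDP (C S A : Type*) (H : ℕ) where
  ctxLaw : PMF C
  dyn : C → LayeredDynamics S A H
  reward : C → S → A → PMF unitInterval
  reward_final : ∀ c a, reward c (dyn c).final a = PMF.pure 0

namespace CMDP

variable {C S A : Type*} {H : ℕ}

/-- The expected reward `r^c(s,a)`. -/
def meanReward (M : CMDP C S A H) (c : C) (s : S) (a : A) : ℝ :=
  expect (M.reward c s a) fun r => (r : ℝ)

/-- Law of the trajectory of an episode with context `c` and policy `π`. -/
def trajLaw (M : CMDP C S A H) (c : C) (π : Policy S A) : PMF (Trajectory S A) :=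
  rollout (M.dyn c).trans (M.reward c) π H (M.dyn c).start

/-- The value `V^π_{M(c)}(s₀) = E[∑_{k<H} r^c(s_k, a_k)]`. -/
def value (M : CMDP C S A H) (c : C) (π : Policy S A) : ℝ :=
  expect (M.trajLaw c π) fun τ => (τ.steps.map fun x => M.meanReward c x.1 x.2.1).sum

/-- The optimal value for the context `c`, a supremum over all stochastic policies
(the values lie in `[0,H]`). -/
def optValue (M : CMDP C S A H) (c : C) : ℝ :=
  ⨆ π : Policy S A, M.value c π

/-- Realizability for `F = G^S`: at each state in which an action is taken, the expected reward,
as a function of the context and the action, belongs to `G`. -/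
def Realizable (M : CMDP C S A H) (G : Finset (C → A → unitInterval)) : Prop :=
  ∃ f : S → C → A → unitInterval, (∀ s, f s ∈ G) ∧
    ∀ c s a, s ≠ (M.dyn c).final → M.meanReward c s a = (f s c a : ℝ)

end CMDP

/-- What the learner has seen after an episode: the context, the policy that it has played, and the
trajectory. -/
structure Episode (C S A : Type*) where
  ctx : C
  policy : Policy S A
  traj : Trajectory S A

/-- A (randomized) algorithm: from the past episodes, in chronological order, and the current
context, it chooses at random the policy of the current episode. -/
abbrev Learner (C S A : Type*) :=
  List (Episode C S A) → C → PMF (Policy S A)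

namespace CMDP

variable {C S A : Type*} {H : ℕ}

/-- Law of the first `T` episodes of the interaction of the learner `L` with `M`. -/
def runLaw (M : CMDP C S A H) (L : Learner C S A) : ℕ → PMF (List (Episode C S A))
  | 0 => PMF.pure []
  | t + 1 =>
      (M.runLaw L t).bind fun h => M.ctxLaw.bind fun c => (L h c).bind fun π =>
        (M.trajLaw c π).map fun τ => h ++ [⟨c, π, τ⟩]

/-- `Regret_T = ∑_t (V^{π*}_{M(c_t)}(s₀) - V^{π_t}_{M(c_t)}(s₀))`. -/
def regret (M : CMDP C S A H) (h : List (Episode C S A)) : ℝ :=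
  (h.map fun e => M.optValue e.ctx - M.value e.ctx e.policy).sum

/-- Expected regret over `T` episodes; the expectation is over the contexts, the randomization of
the learner and the history. -/
def expectedRegret (M : CMDP C S A H) (L : Learner C S A) (T : ℕ) : ℝ :=
  expect (M.runLaw L T) M.regret

end CMDP

end

end CtxMDP

/-!
Let the contexts be uniform on a set of `K ≈ log N / log |A|` points and let each layer move to a
uniform state of the next one, whatever the action. The episodes then probe `M (H - 1) K`
independent bandit problems, one for each inner state and context, and each of these is met with
probability `1 / (M K)` per episode. In every one of them a hidden action has a mean reward
`ε / 2` above that of the others; as the hidden actions may depend on the context arbitrarily,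
a class of `|A| ^ K ≤ N` functions realizes all the choices.

Removing the bonus of one problem costs a relative entropy of at most `ε ^ 2` per play of its hidden
action. Without the bonus the plays, averaged over the candidates for the hidden action, are an
`|A|`-th of all plays, so for `ε ^ 2 ≲ |A| M K / T` the learner cannot tell the hidden action from
the others, misses it a constant fraction of the time and pays `ε T (H - 1)` up to a constant.
-/

namespace CtxMDP

noncomputable section

section Expectation

variable {X Y ι : Type*} {p : PMF X} {f g : X → ℝ}

/-- Boundedness of a function on the support of a discrete law: the integrability condition under
which `expect` is additive and Fubini's theorem holds. -/
def BddUnder (p : PMF X) (f : X → ℝ) : Prop :=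
  ∃ B, ∀ x ∈ p.support, |f x| ≤ B

namespace BddUnder

lemma of_abs_le {B : ℝ} (h : ∀ x, |f x| ≤ B) : BddUnder p f :=
  ⟨B, fun x _ => h x⟩

lemma const (b : ℝ) : BddUnder p fun _ => b :=
  of_abs_le fun _ => le_rfl

lemma add (hf : BddUnder p f) (hg : BddUnder p g) : BddUnder p fun x => f x + g x := by
  obtain ⟨B, hB⟩ := hf
  obtain ⟨B', hB'⟩ := hg
  exact ⟨B + B', fun x hx => (abs_add_le _ _).trans (add_le_add (hB x hx) (hB' x hx))⟩

lemma sum {s : Finset ι} {f : ι → X → ℝ} (hf : ∀ i ∈ s, BddUnder p (f i)) :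
    BddUnder p fun x => ∑ i ∈ s, f i x := by
  choose! B hB using hf
  exact ⟨∑ i ∈ s, B i, fun x hx =>
    (Finset.abs_sum_le_sum_abs _ _).trans (Finset.sum_le_sum fun i hi => hB i hi x hx)⟩

lemma mul (hf : BddUnder p f) (hg : BddUnder p g) : BddUnder p fun x => f x * g x := by
  obtain ⟨B, hB⟩ := hf
  obtain ⟨B', hB'⟩ := hg
  refine ⟨B * B', fun x hx => ?_⟩
  rw [abs_mul]
  exact mul_le_mul (hB x hx) (hB' x hx) (abs_nonneg _) ((abs_nonneg _).trans (hB x hx))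

lemma const_mul (b : ℝ) (hf : BddUnder p f) : BddUnder p fun x => b * f x :=
  (const b).mul hf

lemma sub (hf : BddUnder p f) (hg : BddUnder p g) : BddUnder p fun x => f x - g x := by
  simpa only [neg_one_mul, ← sub_eq_add_neg] using hf.add (hg.const_mul (-1))

lemma of_bind {k : X → PMF Y} {f : Y → ℝ} (hf : BddUnder (p.bind k) f) {x : X}
    (hx : x ∈ p.support) : BddUnder (k x) f := by
  obtain ⟨B, hB⟩ := hf
  exact ⟨B, fun y hy => hB y ((PMF.mem_support_bind_iff p k y).2 ⟨x, hx, hy⟩)⟩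

end BddUnder

lemma summable_toReal_mul {w : X → ENNReal} (hw : ∑' x, w x ≠ ⊤) {B : ℝ}
    (hf : ∀ x, w x ≠ 0 → |f x| ≤ B) : Summable fun x => (w x).toReal * f x := by
  refine Summable.of_norm_bounded ((ENNReal.summable_toReal hw).mul_right B) fun x => ?_
  rw [Real.norm_eq_abs, abs_mul, ENNReal.abs_toReal]
  by_cases h : w x = 0
  · simp [h]
  · exact mul_le_mul_of_nonneg_left (hf x h) ENNReal.toReal_nonneg

lemma BddUnder.summable (hf : BddUnder p f) : Summable fun x => (p x).toReal * f x :=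
  let ⟨_, hB⟩ := hf
  summable_toReal_mul p.tsum_coe_ne_top hB

lemma sum_toReal [Fintype X] (p : PMF X) : ∑ x, (p x).toReal = 1 := by
  rw [← ENNReal.toReal_sum fun x _ => p.apply_ne_top x, ← tsum_fintype (L := .unconditional _),
    p.tsum_coe, ENNReal.toReal_one]

lemma toReal_apply_le_one (p : PMF X) (x : X) : (p x).toReal ≤ 1 :=
  ENNReal.toReal_mono ENNReal.one_ne_top (p.coe_le_one x)

lemma expect_const (p : PMF X) (b : ℝ) : expect p (fun _ => b) = b := by
  rw [expect, tsum_mul_right, ← ENNReal.tsum_toReal_eq fun x => p.apply_ne_top x, p.tsum_coe,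
    ENNReal.toReal_one, one_mul]

lemma expect_congr (h : ∀ x ∈ p.support, f x = g x) : expect p f = expect p g := by
  refine tsum_congr fun x => ?_
  by_cases hx : p x = 0
  · simp [hx]
  · rw [h x hx]

lemma expect_mono (hf : BddUnder p f) (hg : BddUnder p g) (h : ∀ x ∈ p.support, f x ≤ g x) :
    expect p f ≤ expect p g := by
  refine hf.summable.tsum_le_tsum (fun x => ?_) hg.summable
  by_cases hx : p x = 0
  · simp [hx]
  · exact mul_le_mul_of_nonneg_left (h x hx) ENNReal.toReal_nonneg

lemma abs_expect_le {B : ℝ} (hf : ∀ x ∈ p.support, |f x| ≤ B) : |expect p f| ≤ B := by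
  have hl := expect_mono (.const (-B)) ⟨B, hf⟩ fun x hx => (abs_le.1 (hf x hx)).1
  have hu := expect_mono ⟨B, hf⟩ (.const B) fun x hx => (abs_le.1 (hf x hx)).2
  rw [expect_const] at hl hu
  exact abs_le.2 ⟨hl, hu⟩

lemma expect_add (hf : BddUnder p f) (hg : BddUnder p g) :
    expect p (fun x => f x + g x) = expect p f + expect p g := by
  simp only [expect, mul_add]
  exact hf.summable.tsum_add hg.summable

lemma expect_const_mul (p : PMF X) (b : ℝ) (f : X → ℝ) :
    expect p (fun x => b * f x) = b * expect p f := by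
  simp only [expect, mul_left_comm, tsum_mul_left]

lemma expect_sub (hf : BddUnder p f) (hg : BddUnder p g) :
    expect p (fun x => f x - g x) = expect p f - expect p g := by
  simp only [expect, mul_sub]
  exact hf.summable.tsum_sub hg.summable

lemma expect_sum (s : Finset ι) {f : ι → X → ℝ} (hf : ∀ i ∈ s, BddUnder p (f i)) :
    expect p (fun x => ∑ i ∈ s, f i x) = ∑ i ∈ s, expect p (f i) := by
  simp only [expect, Finset.mul_sum]
  exact Summable.tsum_finsetSum fun i hi => (hf i hi).summable

lemma expect_eq_sum [Fintype X] (p : PMF X) (f : X → ℝ) :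
    expect p f = ∑ x, (p x).toReal * f x :=
  tsum_fintype _

lemma expect_pure (x : X) (f : X → ℝ) : expect (PMF.pure x) f = f x := by
  rw [expect, tsum_eq_single x fun y hy => by simp [hy]]
  simp

lemma expect_ite_eq [DecidableEq X] (p : PMF X) (a : X) :
    expect p (fun x => if x = a then 1 else 0) = (p a).toReal := by
  simp [expect]

lemma expect_bind {k : X → PMF Y} {f : Y → ℝ} (hf : BddUnder (p.bind k) f) :
    expect (p.bind k) f = expect p fun x => expect (k x) f := by
  obtain ⟨B, hB⟩ := hf
  have hsum : Summable fun z : X × Y => (p z.1 * k z.1 z.2).toReal * f z.2 := by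
    refine summable_toReal_mul (w := fun z : X × Y => p z.1 * k z.1 z.2)
      (f := fun z => f z.2) (B := B) ?_ fun z hz => hB z.2 ?_
    · rw [ENNReal.tsum_prod (f := fun x y => p x * k x y)]
      simp [ENNReal.tsum_mul_left]
    · exact (PMF.mem_support_bind_iff p k z.2).2
        ⟨z.1, left_ne_zero_of_mul hz, right_ne_zero_of_mul hz⟩
  calc expect (p.bind k) f = ∑' y, ∑' x, (p x * k x y).toReal * f y := by
        refine tsum_congr fun y => ?_
        rw [PMF.bind_apply, ENNReal.tsum_toReal_eq, tsum_mul_right]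
        exact fun x => ENNReal.mul_ne_top (p.apply_ne_top x) ((k x).apply_ne_top y)
    _ = ∑' x, ∑' y, (p x * k x y).toReal * f y :=
        Summable.tsum_comm (f := fun x y => (p x * k x y).toReal * f y) hsum
    _ = expect p fun x => expect (k x) f := by
        simp only [expect, ENNReal.toReal_mul, mul_assoc, tsum_mul_left]

lemma expect_map {k : X → Y} {f : Y → ℝ} (hf : BddUnder (p.map k) f) :
    expect (p.map k) f = expect p fun x => f (k x) := by
  rw [PMF.map, expect_bind hf]
  simp only [Function.comp_apply, expect_pure]

lemma toReal_bind_apply (p : PMF X) (k : X → PMF Y) (y : Y) :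
    ((p.bind k) y).toReal = expect p fun x => (k x y).toReal := by
  rw [PMF.bind_apply, ENNReal.tsum_toReal_eq fun x =>
    ENNReal.mul_ne_top (p.apply_ne_top x) ((k x).apply_ne_top y)]
  simp only [ENNReal.toReal_mul, expect]

lemma expect_uniformOfFintype [Fintype X] [Nonempty X] (f : X → ℝ) :
    expect (PMF.uniformOfFintype X) f = (Fintype.card X : ℝ)⁻¹ * ∑ x, f x := by
  simp [expect_eq_sum, Finset.mul_sum]

end Expectation

section AdditiveCost

variable {S A : Type*} {P : S → A → PMF S} {R : S → A → PMF unitInterval} {π : Policy S A}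
  {g : S → A → unitInterval → ℝ} {B : ℝ}

lemma abs_sum_map_le {X : Type*} {g : X → ℝ} (hg : ∀ x, |g x| ≤ B) (l : List X) :
    |(l.map g).sum| ≤ l.length * B := by
  induction l with
  | nil => simp
  | cons x l ih =>
    simp only [List.map_cons, List.sum_cons, List.length_cons, Nat.cast_add, Nat.cast_one]
    linarith [abs_add_le (g x) (l.map g).sum, hg x]

/-- The sum of a cost over the steps of a trajectory. -/
def stepSum (g : S → A → unitInterval → ℝ) (τ : Trajectory S A) : ℝ :=
  (τ.steps.map fun x => g x.1 x.2.1 x.2.2).sum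

/-- The joint law of the first step of a rollout from the state `s` and of the state it leads to. -/
def stepLaw (P : S → A → PMF S) (R : S → A → PMF unitInterval) (π : Policy S A) (s : S) :
    PMF ((S × A × unitInterval) × S) :=
  (π s).bind fun a => (R s a).bind fun r => (P s a).map fun s' => ((s, a, r), s')

lemma rollout_succ (n : ℕ) (s : S) :
    rollout P R π (n + 1) s = (stepLaw P R π s).bind fun z =>
      (rollout P R π n z.2).map fun τ => ⟨z.1 :: τ.steps, τ.last⟩ := by
  simp only [rollout, stepLaw, PMF.bind_bind, PMF.bind_map, Function.comp_def]

lemma stateLaw_succ' (n : ℕ) (s : S) :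
    stateLaw P π s (n + 1) = (stepLaw P R π s).bind fun z => stateLaw P π z.2 n := by
  have hstep : (stepLaw P R π s).bind (fun z => stateLaw P π z.2 n) =
      (π s).bind fun a => (P s a).bind fun s' => stateLaw P π s' n := by
    simp only [stepLaw, PMF.bind_bind, PMF.bind_map, Function.comp_def, PMF.bind_const]
  rw [hstep]
  clear hstep
  induction n with
  | zero => simp only [stateLaw, PMF.pure_bind, PMF.bind_pure]
  | succ n ih => rw [stateLaw, ih]; simp only [stateLaw, PMF.bind_bind]

lemma length_of_mem_support_rollout {n : ℕ} {s : S} {τ : Trajectory S A}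
    (hτ : τ ∈ (rollout P R π n s).support) : τ.steps.length = n := by
  induction n generalizing s τ with
  | zero =>
    rw [rollout, PMF.mem_support_pure_iff] at hτ
    simp [hτ]
  | succ n ih =>
    simp only [rollout_succ, PMF.mem_support_bind_iff, PMF.mem_support_map_iff] at hτ
    obtain ⟨z, -, τ', hτ', rfl⟩ := hτ
    simp [ih hτ']

lemma abs_stepSum_le (hg : ∀ s a r, |g s a r| ≤ B) {n : ℕ} {s : S} {τ : Trajectory S A}
    (hτ : τ ∈ (rollout P R π n s).support) : |stepSum g τ| ≤ n * B := by
  rw [← length_of_mem_support_rollout hτ]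
  exact abs_sum_map_le (fun _ => hg _ _ _) τ.steps

/-- The expected cost of one step from the state `s`. -/
def stepMean (R : S → A → PMF unitInterval) (π : Policy S A) (g : S → A → unitInterval → ℝ)
    (s : S) : ℝ :=
  expect (π s) fun a => expect (R s a) (g s a)

lemma abs_stepMean_le (hg : ∀ s a r, |g s a r| ≤ B) (s : S) : |stepMean R π g s| ≤ B :=
  abs_expect_le fun a _ => abs_expect_le fun r _ => hg s a r

lemma expect_stepLaw (hg : ∀ s a r, |g s a r| ≤ B) (s : S) :
    (expect (stepLaw P R π s) fun z => g z.1.1 z.1.2.1 z.1.2.2) = stepMean R π g s := by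
  have hbdd {p : PMF ((S × A × unitInterval) × S)} :
      BddUnder p fun z => g z.1.1 z.1.2.1 z.1.2.2 := .of_abs_le fun _ => hg _ _ _
  simp only [stepLaw, stepMean, expect_bind hbdd, expect_map hbdd, expect_const]

lemma expect_rollout_stepSum (hg : ∀ s a r, |g s a r| ≤ B) (n : ℕ) (s : S) :
    expect (rollout P R π n s) (stepSum g) =
      ∑ j ∈ Finset.range n, expect (stateLaw P π s j) (stepMean R π g) := by
  induction n generalizing s with
  | zero => simp [rollout, expect_pure, stepSum]
  | succ n ih =>
    have hsum {n : ℕ} {s : S} : BddUnder (rollout P R π n s) (stepSum g) :=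
      ⟨_, fun _ => abs_stepSum_le hg⟩
    have hmean {p : PMF S} : BddUnder p (stepMean R π g) := .of_abs_le (abs_stepMean_le hg)
    have hcons (z : (S × A × unitInterval) × S) (hz : z ∈ (stepLaw P R π s).support) :
        expect ((rollout P R π n z.2).map fun τ => ⟨z.1 :: τ.steps, τ.last⟩) (stepSum g) =
          g z.1.1 z.1.2.1 z.1.2.2 +
            ∑ j ∈ Finset.range n, expect (stateLaw P π z.2 j) (stepMean R π g) := by
      rw [← ih, expect_map ((rollout_succ n s ▸ hsum).of_bind hz),
        ← expect_const (rollout P R π n z.2) (g _ _ _), ← expect_add (.const _) hsum]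
      rfl
    have hlaw (j : ℕ) : BddUnder (stepLaw P R π s)
        fun z => expect (stateLaw P π z.2 j) (stepMean R π g) :=
      .of_abs_le fun z => abs_expect_le fun s _ => abs_stepMean_le hg s
    calc expect (rollout P R π (n + 1) s) (stepSum g)
        = expect (stepLaw P R π s) fun z => g z.1.1 z.1.2.1 z.1.2.2 +
            ∑ j ∈ Finset.range n, expect (stateLaw P π z.2 j) (stepMean R π g) := by
          rw [rollout_succ, expect_bind (rollout_succ n s ▸ hsum), expect_congr hcons]
      _ = stepMean R π g s +
            ∑ j ∈ Finset.range n, expect (stateLaw P π s (j + 1)) (stepMean R π g) := by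
          rw [expect_add (.of_abs_le fun _ => hg _ _ _) (.sum fun j _ => hlaw j),
            expect_stepLaw hg, expect_sum _ fun j _ => hlaw j]
          simp only [stateLaw_succ' (R := R), expect_bind hmean]
      _ = _ := by
          rw [Finset.sum_range_succ', stateLaw, expect_pure, add_comm]

end AdditiveCost

section LayeredDynamics

variable {C S A : Type*} {H : ℕ}

namespace LayeredDynamics

variable (P : LayeredDynamics S A H) (π : Policy S A)

lemma layer_eq_of_mem_support_stateLaw {l : ℕ} (hl : l ≤ H) {s : S}
    (hs : s ∈ (stateLaw P.trans π P.start l).support) : P.layer s = l := by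
  induction l generalizing s with
  | zero =>
    rw [stateLaw, PMF.mem_support_pure_iff] at hs
    exact (P.layer_eq_zero_iff s).2 hs
  | succ l ih =>
    simp only [stateLaw, PMF.mem_support_bind_iff] at hs
    obtain ⟨x, hx, a, -, hs⟩ := hs
    have hx_layer : P.layer x = l := ih (by omega) hx
    have hx_final : x ≠ P.final := fun h => by
      have := (P.layer_eq_horizon_iff x).2 h
      omega
    rw [P.layer_succ x a s hx_final hs, hx_layer]

/-- The probability that an episode played with `π` visits `s`; only at the time `P.layer s` can
this happen. -/
def visitProb (s : S) : ℝ :=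
  (stateLaw P.trans π P.start (P.layer s) s).toReal

lemma toReal_stateLaw_apply {l : ℕ} (hl : l ≤ H) (s : S) :
    (stateLaw P.trans π P.start l s).toReal = if P.layer s = l then P.visitProb π s else 0 := by
  split_ifs with h
  · rw [visitProb, h]
  · rw [(PMF.apply_eq_zero_iff _ s).2 fun hs => h (P.layer_eq_of_mem_support_stateLaw π hl hs),
      ENNReal.toReal_zero]

lemma sum_expect_stateLaw [Fintype S] (F : S → ℝ) :
    ∑ l ∈ Finset.range H, expect (stateLaw P.trans π P.start l) F =
      ∑ s with P.layer s < H, P.visitProb π s * F s := by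
  have hlayer (l : ℕ) (hl : l ∈ Finset.range H) : expect (stateLaw P.trans π P.start l) F =
      ∑ s, if P.layer s = l then P.visitProb π s * F s else 0 := by
    simp only [expect_eq_sum, P.toReal_stateLaw_apply π (Finset.mem_range.1 hl).le, ite_mul,
      zero_mul]
  rw [Finset.sum_congr rfl hlayer, Finset.sum_comm, Finset.sum_filter]
  simp only [Finset.sum_ite_eq, Finset.mem_range]

lemma sum_visitProb [Fintype S] : ∑ s with P.layer s < H, P.visitProb π s = H := by
  simpa [expect_const] using (P.sum_expect_stateLaw π fun _ => 1).symm

lemma visitProb_nonneg (s : S) : 0 ≤ P.visitProb π s :=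
  ENNReal.toReal_nonneg

end LayeredDynamics

namespace CMDP

variable (E : CMDP C S A H) (c : C) (π : Policy S A)

lemma abs_meanReward_le_one (s : S) (a : A) : |E.meanReward c s a| ≤ 1 :=
  abs_expect_le fun r _ => by rw [abs_of_nonneg r.2.1]; exact r.2.2

lemma abs_value_le : |E.value c π| ≤ H := by
  refine abs_expect_le fun τ hτ => ?_
  rw [← mul_one (H : ℝ)]
  exact abs_stepSum_le (g := fun s a _ => E.meanReward c s a)
    (fun s a _ => E.abs_meanReward_le_one c s a) hτ

lemma value_le_optValue : E.value c π ≤ E.optValue c :=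
  le_ciSup ⟨(H : ℝ), Set.forall_mem_range.2 fun π => (abs_le.1 (E.abs_value_le c π)).2⟩ π

lemma abs_optValue_sub_value_le : |E.optValue c - E.value c π| ≤ 2 * H := by
  have : Nonempty (Policy S A) := ⟨π⟩
  have hopt : E.optValue c ≤ H := ciSup_le fun π => (abs_le.1 (E.abs_value_le c π)).2
  have hval := abs_le.1 (E.abs_value_le c π)
  rw [abs_of_nonneg (sub_nonneg.2 (E.value_le_optValue c π))]
  linarith

variable [Fintype S]

lemma expect_trajLaw_stepSum {g : S → A → unitInterval → ℝ} {B : ℝ} (hg : ∀ s a r, |g s a r| ≤ B) :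
    expect (E.trajLaw c π) (stepSum g) =
      ∑ s with (E.dyn c).layer s < H, (E.dyn c).visitProb π s * stepMean (E.reward c) π g s := by
  rw [trajLaw, expect_rollout_stepSum hg, LayeredDynamics.sum_expect_stateLaw]

lemma value_eq_sum : E.value c π = ∑ s with (E.dyn c).layer s < H,
    (E.dyn c).visitProb π s * expect (π s) (E.meanReward c s) := by
  have h := E.expect_trajLaw_stepSum c π (g := fun s a _ => E.meanReward c s a)
    fun s a _ => E.abs_meanReward_le_one c s a
  simp only [stepMean, expect_const] at h
  exact h

end CMDP

end LayeredDynamics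

section LearningProcess

variable {C S A : Type*} {H : ℕ} (E : CMDP C S A H) (L : Learner C S A)

namespace CMDP

/-- The law of the episode that follows the history `h`. -/
def episodeLaw (h : List (Episode C S A)) : PMF (Episode C S A) :=
  E.ctxLaw.bind fun c => (L h c).bind fun π => (E.trajLaw c π).map fun τ => ⟨c, π, τ⟩

lemma runLaw_succ (t : ℕ) : E.runLaw L (t + 1) =
    (E.runLaw L t).bind fun h => (E.episodeLaw L h).map fun e => h ++ [e] := by
  simp only [runLaw, episodeLaw, PMF.map_bind, PMF.map_comp, Function.comp_def]

/-- The law of the policy that the learner plays in the episode `t` if its context is `c`. -/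
def policyLaw (t : ℕ) (c : C) : PMF (Policy S A) :=
  (E.runLaw L t).bind fun h => L h c

/-- The law of the action that the learner plays in the state `s` in the episode `t` if its context
is `c`. -/
def actionLaw (t : ℕ) (c : C) (s : S) : PMF A :=
  (E.policyLaw L t c).bind fun π => π s

lemma toReal_actionLaw_apply (t : ℕ) (c : C) (s : S) (a : A) :
    (E.actionLaw L t c s a).toReal =
      expect (E.runLaw L t) fun h => (((L h c).bind fun π => π s) a).toReal := by
  rw [actionLaw, policyLaw, PMF.bind_bind, toReal_bind_apply]

lemma runLaw_bind_episodeLaw (t : ℕ) : (E.runLaw L t).bind (E.episodeLaw L) =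
    E.ctxLaw.bind fun c => (E.policyLaw L t c).bind fun π =>
      (E.trajLaw c π).map fun τ => ⟨c, π, τ⟩ := by
  simp only [policyLaw, PMF.bind_bind]
  rw [PMF.bind_comm]
  rfl

variable {L} {F : Episode C S A → ℝ} {B : ℝ}

lemma abs_le_of_mem_support_episodeLaw
    (hF : ∀ c π, ∀ τ ∈ (E.trajLaw c π).support, |F ⟨c, π, τ⟩| ≤ B) {h : List (Episode C S A)}
    {e : Episode C S A} (he : e ∈ (E.episodeLaw L h).support) : |F e| ≤ B := by
  simp only [episodeLaw, PMF.mem_support_bind_iff, PMF.mem_support_map_iff] at he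
  obtain ⟨c, -, π, -, τ, hτ, rfl⟩ := he
  exact hF c π τ hτ

lemma bddUnder_bind_episodeLaw (hF : ∀ c π, ∀ τ ∈ (E.trajLaw c π).support, |F ⟨c, π, τ⟩| ≤ B)
    (p : PMF (List (Episode C S A))) : BddUnder (p.bind (E.episodeLaw L)) F :=
  ⟨B, fun _ he =>
    let ⟨_, _, he⟩ := (PMF.mem_support_bind_iff _ _ _).1 he
    E.abs_le_of_mem_support_episodeLaw hF he⟩

lemma bddUnder_runLaw_sum (hF : ∀ c π, ∀ τ ∈ (E.trajLaw c π).support, |F ⟨c, π, τ⟩| ≤ B) (t : ℕ) :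
    BddUnder (E.runLaw L t) fun h => (h.map F).sum := by
  refine ⟨t * B, fun h hh => ?_⟩
  induction t generalizing h with
  | zero =>
    rw [runLaw, PMF.mem_support_pure_iff] at hh
    simp [hh]
  | succ t ih =>
    simp only [runLaw_succ, PMF.mem_support_bind_iff, PMF.mem_support_map_iff] at hh
    obtain ⟨h', hh', e, he, rfl⟩ := hh
    have hF_e := E.abs_le_of_mem_support_episodeLaw hF he
    simp only [List.map_append, List.map_cons, List.map_nil, List.sum_append, List.sum_singleton,
      Nat.cast_add, Nat.cast_one]
    linarith [abs_add_le (h'.map F).sum (F e), ih h' hh']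

lemma expect_bind_episodeLaw (hF : ∀ c π, ∀ τ ∈ (E.trajLaw c π).support, |F ⟨c, π, τ⟩| ≤ B)
    (t : ℕ) : expect ((E.runLaw L t).bind (E.episodeLaw L)) F =
      expect E.ctxLaw fun c => expect (E.policyLaw L t c) fun π =>
        expect (E.trajLaw c π) fun τ => F ⟨c, π, τ⟩ := by
  have hbdd := E.bddUnder_bind_episodeLaw (L := L) hF (E.runLaw L t)
  rw [runLaw_bind_episodeLaw] at hbdd ⊢
  rw [expect_bind hbdd]
  refine expect_congr fun c hc => ?_
  rw [expect_bind (hbdd.of_bind hc)]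
  exact expect_congr fun π hπ => expect_map ((hbdd.of_bind hc).of_bind hπ)

lemma expect_runLaw_sum (hF : ∀ c π, ∀ τ ∈ (E.trajLaw c π).support, |F ⟨c, π, τ⟩| ≤ B) (t : ℕ) :
    expect (E.runLaw L t) (fun h => (h.map F).sum) =
      ∑ i ∈ Finset.range t, expect E.ctxLaw fun c => expect (E.policyLaw L i c) fun π =>
        expect (E.trajLaw c π) fun τ => F ⟨c, π, τ⟩ := by
  induction t with
  | zero => simp [runLaw, expect_pure]
  | succ t ih =>
    have hepisode (h : List (Episode C S A)) : BddUnder (E.episodeLaw L h) F :=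
      ⟨B, fun _ => E.abs_le_of_mem_support_episodeLaw hF⟩
    have hsum := E.runLaw_succ L t ▸ E.bddUnder_runLaw_sum (L := L) hF (t + 1)
    have happend (h : List (Episode C S A)) (hh : h ∈ (E.runLaw L t).support) :
        expect ((E.episodeLaw L h).map fun e => h ++ [e]) (fun h => (h.map F).sum) =
          (h.map F).sum + expect (E.episodeLaw L h) F := by
      rw [expect_map (hsum.of_bind hh)]
      simp only [List.map_append, List.map_cons, List.map_nil, List.sum_append, List.sum_singleton]
      rw [expect_add (.const _) (hepisode h), expect_const]
    rw [Finset.sum_range_succ, ← ih, ← expect_bind_episodeLaw E hF,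
      expect_bind (E.bddUnder_bind_episodeLaw hF _), runLaw_succ, expect_bind hsum,
      expect_congr happend, expect_add (E.bddUnder_runLaw_sum hF t)
        (.of_abs_le fun h => abs_expect_le fun _ => E.abs_le_of_mem_support_episodeLaw hF)]

lemma expectedRegret_eq_sum (T : ℕ) : E.expectedRegret L T =
    ∑ t ∈ Finset.range T, expect E.ctxLaw fun c => expect (E.policyLaw L t c) fun π =>
      E.optValue c - E.value c π := by
  refine (E.expect_runLaw_sum (F := fun e => E.optValue e.ctx - E.value e.ctx e.policy)
    (fun c π _ _ => E.abs_optValue_sub_value_le c π) T).trans ?_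
  simp only [expect_const]

end CMDP

end LearningProcess

section ChangeOfMeasure

variable {X Y : Type*} {p q : PMF X} {u : X → ℝ}

/-- The discrete law `q` has the log-likelihood ratio `u` with respect to `p`. -/
def HasLogDensity (p q : PMF X) (u : X → ℝ) : Prop :=
  ∀ x, q x = p x * ENNReal.ofReal (Real.exp (u x))

lemma one_sub_exp_neg_mul_le {y : ℝ} (hy : y ∈ Set.Icc 0 1) (l v : ℝ) :
    (1 - Real.exp (-l)) * (Real.exp v * y) ≤ Real.exp v - 1 + (l * y - v) := by
  have hconvex : Real.exp (y * -l) ≤ 1 - y + y * Real.exp (-l) := by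
    simpa using convexOn_exp.2 (Set.mem_univ 0) (Set.mem_univ (-l)) (sub_nonneg.2 hy.2) hy.1
      (sub_add_cancel 1 y)
  have htangent : v + y * -l + 1 ≤ Real.exp v * Real.exp (y * -l) :=
    (Real.add_one_le_exp _).trans_eq (Real.exp_add _ _)
  linarith [mul_le_mul_of_nonneg_left hconvex (Real.exp_nonneg v)]

namespace HasLogDensity

lemma refl (p : PMF X) : HasLogDensity p p fun _ => 0 := fun x => by simp

lemma pure {x : X} (hx : u x = 0) : HasLogDensity (PMF.pure x) (PMF.pure x) u := fun y => by
  by_cases hy : y = x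
  · simp [hy, hx]
  · simp [hy]

lemma bind {k k' : X → PMF Y} {v : Y → ℝ} (h : HasLogDensity p q u)
    (hk : ∀ x, HasLogDensity (k x) (k' x) fun y => v y - u x) :
    HasLogDensity (p.bind k) (q.bind k') v := fun y => by
  simp only [PMF.bind_apply, ← ENNReal.tsum_mul_right]
  refine tsum_congr fun x => ?_
  rw [h x, hk x y, mul_mul_mul_comm, ← ENNReal.ofReal_mul (Real.exp_nonneg _), ← Real.exp_add,
    add_sub_cancel]

lemma map {f : X → Y} {v : Y → ℝ} (h : HasLogDensity p q fun x => v (f x)) :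
    HasLogDensity (p.map f) (q.map f) v := fun y => by
  simp only [PMF.map_apply, ← ENNReal.tsum_mul_right]
  refine tsum_congr fun x => ?_
  split_ifs with hy
  · rw [hy, h x]
  · rw [zero_mul]

lemma expect_eq (h : HasLogDensity p q u) (f : X → ℝ) :
    expect q f = expect p fun x => Real.exp (u x) * f x :=
  tsum_congr fun x => by
    rw [h x, ENNReal.toReal_mul, ENNReal.toReal_ofReal (Real.exp_nonneg _), mul_assoc]

/-- The Donsker–Varadhan inequality for the observable `-l * f`, with its logarithm linearized. -/
lemma mul_expect_le (h : HasLogDensity p q u) (hu : BddUnder p u) {f : X → ℝ}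
    (hf : ∀ x, f x ∈ Set.Icc 0 1) (l : ℝ) :
    (1 - Real.exp (-l)) * expect q f ≤ l * expect p f - expect p u := by
  have hexp : BddUnder p fun x => Real.exp (u x) := by
    obtain ⟨B, hB⟩ := hu
    refine ⟨Real.exp B, fun x hx => ?_⟩
    rw [abs_of_pos (Real.exp_pos _), Real.exp_le_exp]
    exact (abs_le.1 (hB x hx)).2
  have hexp_mean : expect p (fun x => Real.exp (u x)) = 1 := by
    simpa only [mul_one, expect_const] using (h.expect_eq fun _ => 1).symm
  have hf_bdd : BddUnder p f := .of_abs_le fun x => (abs_of_nonneg (hf x).1).trans_le (hf x).2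
  have hlinear : BddUnder p fun x => l * f x - u x := (hf_bdd.const_mul l).sub hu
  calc (1 - Real.exp (-l)) * expect q f
      = expect p fun x => (1 - Real.exp (-l)) * (Real.exp (u x) * f x) := by
        rw [expect_const_mul, h.expect_eq]
    _ ≤ expect p fun x => Real.exp (u x) - 1 + (l * f x - u x) :=
        expect_mono ((hexp.mul hf_bdd).const_mul _) ((hexp.sub (.const 1)).add hlinear)
          fun x _ => one_sub_exp_neg_mul_le (hf x) l (u x)
    _ = l * expect p f - expect p u := by
        rw [expect_add (hexp.sub (.const 1)) hlinear, expect_sub hexp (.const 1), hexp_mean,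
          expect_const, sub_self, zero_add, expect_sub (hf_bdd.const_mul l) hu, expect_const_mul]

end HasLogDensity

lemma hasLogDensity_rollout {S A : Type*} {P : S → A → PMF S} {R R' : S → A → PMF unitInterval}
    {g : S → A → unitInterval → ℝ} (hR : ∀ s a, HasLogDensity (R s a) (R' s a) (g s a))
    (π : Policy S A) (n : ℕ) (s : S) :
    HasLogDensity (rollout P R π n s) (rollout P R' π n s) (stepSum g) := by
  have hstep (s : S) : HasLogDensity (stepLaw P R π s) (stepLaw P R' π s)
      fun z => g z.1.1 z.1.2.1 z.1.2.2 := by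
    refine (HasLogDensity.refl (π s)).bind fun a => HasLogDensity.bind (u := g s a) ?_ fun r => ?_
    · exact hR s a
    · refine HasLogDensity.map ?_
      simpa using HasLogDensity.refl (P s a)
  induction n generalizing s with
  | zero =>
    exact .pure rfl
  | succ n ih =>
    rw [rollout_succ, rollout_succ]
    refine (hstep s).bind fun z => .map ?_
    simp only [stepSum, List.map_cons, List.sum_cons, add_sub_cancel_left]
    exact ih z.2

lemma CMDP.hasLogDensity_runLaw {C S A : Type*} {H : ℕ} {E E' : CMDP C S A H}
    (hctx : E'.ctxLaw = E.ctxLaw) (hdyn : E'.dyn = E.dyn) {g : C → S → A → unitInterval → ℝ}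
    (hR : ∀ c s a, HasLogDensity (E.reward c s a) (E'.reward c s a) (g c s a))
    (L : Learner C S A) (t : ℕ) :
    HasLogDensity (E.runLaw L t) (E'.runLaw L t)
      fun h => (h.map fun e => stepSum (g e.ctx) e.traj).sum := by
  induction t with
  | zero => exact .pure rfl
  | succ t ih =>
    rw [runLaw_succ, runLaw_succ]
    refine ih.bind fun h => .map ?_
    simp only [List.map_append, List.map_cons, List.map_nil, List.sum_append, List.sum_singleton,
      add_sub_cancel_left]
    rw [episodeLaw, episodeLaw, hctx]
    refine (HasLogDensity.refl _).bind fun c => (HasLogDensity.refl _).bind fun π => .map ?_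
    simp only [sub_zero]
    rw [trajLaw, trajLaw, hdyn]
    exact hasLogDensity_rollout (hR c) π H _

end ChangeOfMeasure

section Coin

/-- The Bernoulli law with mean `m`, as a law on rewards. -/
def coin (m : unitInterval) : PMF unitInterval :=
  (PMF.ofFintype (fun b : Bool => ENNReal.ofReal (if b then (m : ℝ) else 1 - m)) (by
    simp [← ENNReal.ofReal_add m.2.1 (sub_nonneg.2 m.2.2)])).map fun b => if b then 1 else 0

lemma expect_coin (m : unitInterval) (f : unitInterval → ℝ) :
    expect (coin m) f = m * f 1 + (1 - m) * f 0 := by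
  have hbdd : BddUnder (coin m) f := by
    refine ⟨max |f 1| |f 0|, fun r hr => ?_⟩
    obtain ⟨b, -, rfl⟩ := (PMF.mem_support_map_iff _ _ _).1 hr
    cases b <;> simp
  rw [coin, expect_map hbdd, expect_eq_sum]
  simp [ENNReal.toReal_ofReal, m.2.1, m.2.2]

lemma hasLogDensity_coin {m m' : unitInterval} {u : unitInterval → ℝ}
    (h₁ : (m' : ℝ) = m * Real.exp (u 1)) (h₀ : 1 - (m' : ℝ) = (1 - m) * Real.exp (u 0)) :
    HasLogDensity (coin m) (coin m') u := by
  refine HasLogDensity.map fun b => ?_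
  cases b
  · simp [h₀, ENNReal.ofReal_mul, sub_nonneg.2 m.2.2]
  · simp [h₁, ENNReal.ofReal_mul, m.2.1]

end Coin

lemma neg_sq_le_log_one_sub_sq_div_two {y : ℝ} (hy : y ^ 2 ≤ 1 / 2) :
    -y ^ 2 ≤ Real.log (1 - y ^ 2) / 2 := by
  have hpos : 0 < 1 - y ^ 2 := by linarith
  have hlog := Real.one_sub_inv_le_log_of_pos hpos
  have hinv : (1 - y ^ 2)⁻¹ ≤ 1 + 2 * y ^ 2 := by
    rw [inv_le_iff_one_le_mul₀ hpos]
    nlinarith [sq_nonneg y]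
  linarith

lemma neg_expect_log_mul_visitProb_le {S A : Type*} {H : ℕ} {P : LayeredDynamics S A H} {s : S}
    {q y : ℝ} (hy : y ^ 2 ≤ 1 / 2) (hq : ∀ π, P.visitProb π s ≤ q) (p : PMF (Policy S A)) (a : A) :
    -(expect p fun π => Real.log (1 - y ^ 2) / 2 * (P.visitProb π s * (π s a).toReal)) ≤
      y ^ 2 * q * ((p.bind fun π => π s) a).toReal := by
  have hplay (π : Policy S A) : 0 ≤ (π s a).toReal := ENNReal.toReal_nonneg
  have hplay_bdd : BddUnder p fun π => (π s a).toReal :=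
    .of_abs_le fun π => (abs_of_nonneg (hplay π)).trans_le (toReal_apply_le_one _ _)
  have hvisit_bdd : BddUnder p fun π => P.visitProb π s :=
    .of_abs_le fun π => (abs_of_nonneg (P.visitProb_nonneg π s)).trans_le (hq π)
  have hpoint (π : Policy S A) : -(y ^ 2 * q) * (π s a).toReal ≤
      Real.log (1 - y ^ 2) / 2 * (P.visitProb π s * (π s a).toReal) := by
    rw [← mul_assoc]
    refine mul_le_mul_of_nonneg_right ?_ (hplay π)
    nlinarith [mul_le_mul_of_nonneg_left (hq π) (sq_nonneg y), mul_le_mul_of_nonneg_right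
      (neg_sq_le_log_one_sub_sq_div_two hy) (P.visitProb_nonneg π s)]
  have hmean := expect_mono (hplay_bdd.const_mul _) ((hvisit_bdd.mul hplay_bdd).const_mul _)
    fun π _ => hpoint π
  rw [expect_const_mul] at hmean
  rw [toReal_bind_apply]
  linarith

section BanditInstance

variable {C S A : Type*} {H : ℕ} [DecidableEq A] {ε : unitInterval}

/-- The mean reward of the action `a` when the action `best`, if any, is better than the others by
`ε / 2`. -/
def armMean (ε : unitInterval) (best : Option A) (a : A) : unitInterval :=
  ⟨(1 + if best = some a then (ε : ℝ) else 0) / 2, by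
    obtain ⟨hε₀, hε₁⟩ := ε.2
    split_ifs <;> constructor <;> linarith⟩

lemma expect_armMean_some (p : PMF A) (a : A) :
    expect p (fun b => (armMean ε (some a) b : ℝ)) = (1 + ε * (p a).toReal) / 2 := by
  have hsplit (b : A) :
      (armMean ε (some a) b : ℝ) = 1 / 2 + ε / 2 * if b = a then 1 else 0 := by
    simp only [armMean, Option.some.injEq, eq_comm (a := a)]
    split_ifs <;> ring
  simp only [hsplit]
  rw [expect_add (.const _) (.const_mul _ (.of_abs_le (B := 1) fun b => by split_ifs <;> simp)),
    expect_const, expect_const_mul, expect_ite_eq]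
  ring

/-- The reward functions that a single state can have in the problems `banditCMDP P ε φ` with a
unique best action everywhere. -/
def banditClass (C A : Type*) [Fintype C] [Fintype A] [DecidableEq C] [DecidableEq A]
    (ε : unitInterval) : Finset (C → A → unitInterval) :=
  Finset.univ.image fun (ψ : C → A) c => armMean ε (some (ψ c))

lemma card_banditClass_le [Fintype C] [Fintype A] [DecidableEq C] :
    (banditClass C A ε).card ≤ Fintype.card A ^ Fintype.card C :=
  Finset.card_image_le.trans_eq (by rw [Finset.card_univ, Fintype.card_fun])

section LogRatio

variable [DecidableEq S] [DecidableEq C]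

/-- The log-likelihood ratio of the reward `r` of the action `b` when the action `a` becomes the
best one at `x`, all actions at `x` having been equally good. -/
def logRatio (ε : unitInterval) (x : S × C) (a : A) (c : C) (s : S) (b : A) (r : unitInterval) :
    ℝ :=
  if (s, c) = x ∧ b = a then Real.log (1 + ε * (2 * r - 1)) else 0

lemma abs_logRatio_le (hε : (ε : ℝ) ≤ 1 / 2) (x : S × C) (a : A) (c : C) (s : S) (b : A)
    (r : unitInterval) : |logRatio ε x a c s b r| ≤ 1 := by
  obtain ⟨⟨hε₀, -⟩, hr₀, hr₁⟩ := And.intro ε.2 r.2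
  unfold logRatio
  split_ifs
  · have hlow : 1 / 2 ≤ 1 + (ε : ℝ) * (2 * r - 1) := by nlinarith
    have hlog := Real.one_sub_inv_le_log_of_pos (one_half_pos.trans_le hlow)
    have hinv := inv_anti₀ one_half_pos hlow
    have hupp := Real.log_le_sub_one_of_pos (one_half_pos.trans_le hlow)
    rw [abs_le]
    constructor
    · norm_num at hinv
      linarith
    · nlinarith
  · simp

end LogRatio

variable [Fintype C] [Nonempty C]

/-- The contextual bandit problem on the layered dynamics `P`: contexts are uniform, and in each
nonfinal state `s` and context `c` the rewards are Bernoulli with the means `armMean ε (φ (s, c))`.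
If `φ (s, c) = none`, all actions there are equally good. -/
def banditCMDP (P : LayeredDynamics S A H) (ε : unitInterval) (φ : S × C → Option A) :
    CMDP C S A H where
  ctxLaw := PMF.uniformOfFintype C
  dyn _ := P
  reward c s a := if P.layer s < H then coin (armMean ε (φ (s, c)) a) else PMF.pure 0
  reward_final _ _ := if_neg (by rw [(P.layer_eq_horizon_iff _).2 rfl]; exact lt_irrefl H)

variable {P : LayeredDynamics S A H}

lemma banditCMDP_reward (φ : S × C → Option A) {s : S} (hs : P.layer s < H) (c : C) (a : A) :
    (banditCMDP P ε φ).reward c s a = coin (armMean ε (φ (s, c)) a) :=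
  if_pos hs

lemma banditCMDP_meanReward (φ : S × C → Option A) {s : S} (hs : P.layer s < H) (c : C) :
    (banditCMDP P ε φ).meanReward c s = fun a => (armMean ε (φ (s, c)) a : ℝ) := by
  funext a
  rw [CMDP.meanReward, banditCMDP_reward φ hs, expect_coin]
  simp

lemma banditCMDP_realizable [Fintype A] [DecidableEq C] (φ : S × C → A) :
    (banditCMDP P ε (some ∘ φ)).Realizable (banditClass C A ε) := by
  refine ⟨fun s c => armMean ε (some (φ (s, c))),
    fun s => Finset.mem_image_of_mem _ (Finset.mem_univ _), fun c s a hs => ?_⟩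
  have hlayer : P.layer s < H :=
    (P.layer_le s).lt_of_ne fun h => hs ((P.layer_eq_horizon_iff s).1 h)
  rw [banditCMDP_meanReward _ hlayer, Function.comp_apply]

section Regret

variable (φ : S × C → A)

lemma banditCMDP_value [Fintype S] (c : C) (π : Policy S A) :
    (banditCMDP P ε (some ∘ φ)).value c π =
      ∑ s with P.layer s < H, P.visitProb π s * ((1 + ε * (π s (φ (s, c))).toReal) / 2) := by
  rw [CMDP.value_eq_sum]
  refine Finset.sum_congr rfl fun s hs => ?_
  rw [banditCMDP_meanReward _ (Finset.mem_filter.1 hs).2, Function.comp_apply, expect_armMean_some]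
  rfl

lemma le_banditCMDP_optValue [Finite S] (c : C) :
    (1 + (ε : ℝ)) / 2 * H ≤ (banditCMDP P ε (some ∘ φ)).optValue c := by
  have := Fintype.ofFinite S
  refine le_trans (le_of_eq ?_) (CMDP.value_le_optValue _ c fun s => PMF.pure (φ (s, c)))
  rw [banditCMDP_value, ← P.sum_visitProb fun s => PMF.pure (φ (s, c)), Finset.mul_sum]
  refine Finset.sum_congr rfl fun s _ => ?_
  rw [PMF.pure_apply_self, ENNReal.toReal_one, mul_one, mul_comm]

lemma le_banditCMDP_optValue_sub_value [Fintype S] (c : C) (π : Policy S A) :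
    ε / 2 * ∑ s with P.layer s < H, P.visitProb π s * (1 - (π s (φ (s, c))).toReal) ≤
      (banditCMDP P ε (some ∘ φ)).optValue c - (banditCMDP P ε (some ∘ φ)).value c π := by
  refine le_trans (le_of_eq ?_) (sub_le_sub_right (le_banditCMDP_optValue φ c) _)
  rw [banditCMDP_value, ← P.sum_visitProb π, Finset.mul_sum, Finset.mul_sum,
    ← Finset.sum_sub_distrib]
  exact Finset.sum_congr rfl fun s _ => by ring

lemma le_banditCMDP_gap [Finite S] {I : Finset S} (hI : ∀ s ∈ I, P.layer s < H) {p : ℝ}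
    (hp : ∀ π, ∀ s ∈ I, p ≤ P.visitProb π s) (c : C) (π : Policy S A) :
    ε / 2 * p * ∑ s ∈ I, (1 - (π s (φ (s, c))).toReal) ≤
      (banditCMDP P ε (some ∘ φ)).optValue c - (banditCMDP P ε (some ∘ φ)).value c π := by
  have := Fintype.ofFinite S
  refine le_trans ?_ (le_banditCMDP_optValue_sub_value φ c π)
  have hsub (s : S) : 0 ≤ 1 - (π s (φ (s, c))).toReal := sub_nonneg.2 (toReal_apply_le_one _ _)
  rw [mul_assoc, Finset.mul_sum]
  refine mul_le_mul_of_nonneg_left ?_ (div_nonneg ε.2.1 zero_le_two)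
  calc ∑ s ∈ I, p * (1 - (π s (φ (s, c))).toReal)
      ≤ ∑ s ∈ I, P.visitProb π s * (1 - (π s (φ (s, c))).toReal) :=
        Finset.sum_le_sum fun s hs => mul_le_mul_of_nonneg_right (hp π s hs) (hsub s)
    _ ≤ ∑ s with P.layer s < H, P.visitProb π s * (1 - (π s (φ (s, c))).toReal) :=
        Finset.sum_le_sum_of_subset_of_nonneg
          (fun s hs => Finset.mem_filter.2 ⟨Finset.mem_univ s, hI s hs⟩)
          fun s _ _ => mul_nonneg (P.visitProb_nonneg π s) (hsub s)

lemma le_banditCMDP_expectedRegret [Finite S] {I : Finset S} (hI : ∀ s ∈ I, P.layer s < H)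
    {p : ℝ} (hp : ∀ π, ∀ s ∈ I, p ≤ P.visitProb π s) (L : Learner C S A) (T : ℕ) :
    ε / 2 * p * ∑ t ∈ Finset.range T, (Fintype.card C : ℝ)⁻¹ * ∑ c, ∑ s ∈ I,
        (1 - ((banditCMDP P ε (some ∘ φ)).actionLaw L t c s (φ (s, c))).toReal) ≤
      (banditCMDP P ε (some ∘ φ)).expectedRegret L T := by
  set E := banditCMDP P ε (some ∘ φ)
  have hplay {p : PMF (Policy S A)} {c : C} {s : S} : BddUnder p fun π => (π s (φ (s, c))).toReal :=
    .of_abs_le fun π => (abs_of_nonneg ENNReal.toReal_nonneg).trans_le (toReal_apply_le_one _ _)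
  have hmiss (t : ℕ) (c : C) :
      (expect (E.policyLaw L t c) fun π => ε / 2 * p * ∑ s ∈ I, (1 - (π s (φ (s, c))).toReal)) =
        ε / 2 * p * ∑ s ∈ I, (1 - (E.actionLaw L t c s (φ (s, c))).toReal) := by
    rw [expect_const_mul, expect_sum I fun s _ => (BddUnder.const 1).sub hplay]
    simp only [expect_sub (.const _) hplay, expect_const, CMDP.actionLaw, toReal_bind_apply]
  rw [CMDP.expectedRegret_eq_sum, Finset.mul_sum]
  refine Finset.sum_le_sum fun t _ => ?_
  rw [show E.ctxLaw = PMF.uniformOfFintype C from rfl, expect_uniformOfFintype, mul_left_comm,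
    Finset.mul_sum]
  gcongr with c
  rw [← hmiss]
  exact expect_mono (.const_mul _ (.sum fun s _ => (BddUnder.const 1).sub hplay))
    (.of_abs_le fun π => E.abs_optValue_sub_value_le c π) fun π _ =>
      le_banditCMDP_gap φ hI hp c π

end Regret

section Information

variable [DecidableEq S] [DecidableEq C]

lemma hasLogDensity_banditCMDP_reward (hε : (ε : ℝ) ≤ 1 / 2) {φ : S × C → Option A} {x : S × C}
    (hφ : φ x = none) (hx : P.layer x.1 < H) (a : A) (c : C) (s : S) (b : A) :
    HasLogDensity ((banditCMDP P ε φ).reward c s b)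
      ((banditCMDP P ε (Function.update φ x (some a))).reward c s b) (logRatio ε x a c s b) := by
  by_cases h : (s, c) = x ∧ b = a
  · obtain ⟨rfl, rfl⟩ := h
    have hε₀ := ε.2.1
    rw [banditCMDP_reward _ hx, banditCMDP_reward _ hx, Function.update_self, hφ]
    apply hasLogDensity_coin <;>
      simp only [armMean, logRatio, and_self, if_true, reduceCtorEq, if_false,
        Set.Icc.coe_one, Set.Icc.coe_zero] <;>
      rw [Real.exp_log (by linarith)] <;> ring
  · have hreward : (banditCMDP P ε (Function.update φ x (some a))).reward c s b =
        (banditCMDP P ε φ).reward c s b := by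
      by_cases hsc : (s, c) = x
      · have hb : a ≠ b := fun hab => h ⟨hsc, hab.symm⟩
        simp [banditCMDP, armMean, hsc, hφ, hb]
      · simp only [banditCMDP, Function.update_of_ne hsc]
    have hratio : logRatio ε x a c s b = fun _ => 0 := funext fun _ => if_neg h
    rw [hreward, hratio]
    exact .refl _

lemma expect_logRatio (hε : (ε : ℝ) ≤ 1 / 2) {φ : S × C → Option A} {x : S × C}
    (hφ : φ x = none) (hx : P.layer x.1 < H) (a : A) (c : C) (s : S) (b : A) :
    expect ((banditCMDP P ε φ).reward c s b) (logRatio ε x a c s b) =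
      Real.log (1 - (ε : ℝ) ^ 2) / 2 * if (s, c) = x ∧ b = a then 1 else 0 := by
  by_cases h : (s, c) = x ∧ b = a
  · obtain ⟨rfl, rfl⟩ := h
    have hε₀ := ε.2.1
    rw [banditCMDP_reward _ hx, expect_coin, hφ,
      show 1 - (ε : ℝ) ^ 2 = (1 + ε) * (1 - ε) by ring, Real.log_mul (by linarith) (by linarith)]
    simp only [armMean, logRatio, and_self, if_true, reduceCtorEq, if_false,
      Set.Icc.coe_one, Set.Icc.coe_zero]
    ring_nf
  · have hratio : logRatio ε x a c s b = fun _ => 0 := funext fun _ => if_neg h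
    rw [hratio, expect_const, if_neg h, mul_zero]

lemma stepMean_logRatio (hε : (ε : ℝ) ≤ 1 / 2) {φ : S × C → Option A} {x : S × C}
    (hφ : φ x = none) (hx : P.layer x.1 < H) (a : A) (c : C) (π : Policy S A) (s : S) :
    stepMean ((banditCMDP P ε φ).reward c) π (logRatio ε x a c) s =
      Real.log (1 - (ε : ℝ) ^ 2) / 2 * if (s, c) = x then (π s a).toReal else 0 := by
  simp only [stepMean, expect_logRatio hε hφ hx, expect_const_mul]
  split_ifs with h
  · simp only [h, true_and, expect_ite_eq]
  · simp only [h, false_and, if_false, expect_const]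

variable [Finite S]

lemma expect_trajLaw_logRatio (hε : (ε : ℝ) ≤ 1 / 2) {φ : S × C → Option A} {x : S × C}
    (hφ : φ x = none) (hx : P.layer x.1 < H) (a : A) (c : C) (π : Policy S A) :
    expect ((banditCMDP P ε φ).trajLaw c π) (stepSum (logRatio ε x a c)) =
      if c = x.2 then Real.log (1 - (ε : ℝ) ^ 2) / 2 * (P.visitProb π x.1 * (π x.1 a).toReal)
      else 0 := by
  have := Fintype.ofFinite S
  rw [CMDP.expect_trajLaw_stepSum _ c π (abs_logRatio_le hε x a c)]
  simp only [stepMean_logRatio hε hφ hx]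
  change ∑ s with P.layer s < H, P.visitProb π s * _ = _
  rw [Finset.sum_eq_single_of_mem x.1 (by simpa using hx)]
  · simp only [Prod.ext_iff, true_and, mul_ite, mul_zero]
    split_ifs <;> ring
  · intro s _ hs
    rw [if_neg fun h => hs (congrArg Prod.fst h), mul_zero, mul_zero]

lemma neg_expect_logRatio_le (hε : (ε : ℝ) ≤ 1 / 2) {φ : S × C → Option A} {x : S × C}
    (hφ : φ x = none) (hx : P.layer x.1 < H) {q : ℝ} (hq : ∀ π, P.visitProb π x.1 ≤ q)
    (L : Learner C S A) (a : A) (t : ℕ) :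
    -expect ((banditCMDP P ε φ).runLaw L t)
        (fun h => (h.map fun e => stepSum (logRatio ε x a e.ctx) e.traj).sum) ≤
      ε ^ 2 * (q / Fintype.card C) * ∑ i ∈ Finset.range t,
        ((banditCMDP P ε φ).actionLaw L i x.2 x.1 a).toReal := by
  set E := banditCMDP P ε φ
  set D := Real.log (1 - (ε : ℝ) ^ 2) / 2
  have hepisode (i : ℕ) : (expect E.ctxLaw fun c => expect (E.policyLaw L i c) fun π =>
      expect (E.trajLaw c π) (stepSum (logRatio ε x a c))) = (Fintype.card C : ℝ)⁻¹ *
        expect (E.policyLaw L i x.2) fun π => D * (P.visitProb π x.1 * (π x.1 a).toReal) := by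
    rw [show E.ctxLaw = PMF.uniformOfFintype C from rfl, expect_uniformOfFintype]
    simp only [E, expect_trajLaw_logRatio hε hφ hx]
    rw [Finset.sum_eq_single x.2]
    · simp [D]
    · intro c _ hc
      simp only [if_neg hc, expect_const]
    · simp
  rw [E.expect_runLaw_sum (F := fun e => stepSum (logRatio ε x a e.ctx) e.traj)
    fun c π τ => abs_stepSum_le (abs_logRatio_le hε x a c)]
  simp only [hepisode]
  rw [← Finset.sum_neg_distrib, Finset.mul_sum]
  refine Finset.sum_le_sum fun i _ => ?_
  have hvisit := neg_expect_log_mul_visitProb_le (P := P) (y := ε) (by nlinarith [ε.2.1]) hq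
    (E.policyLaw L i x.2) a
  calc -((Fintype.card C : ℝ)⁻¹ * expect (E.policyLaw L i x.2) fun π =>
          D * (P.visitProb π x.1 * (π x.1 a).toReal))
      ≤ (Fintype.card C : ℝ)⁻¹ * (ε ^ 2 * q * (E.actionLaw L i x.2 x.1 a).toReal) := by
        rw [← mul_neg]
        gcongr
        exact hvisit
    _ = ε ^ 2 * (q / Fintype.card C) * (E.actionLaw L i x.2 x.1 a).toReal := by ring

lemma one_sub_exp_neg_mul_actionLaw_le (hε : (ε : ℝ) ≤ 1 / 2) {φ : S × C → Option A} {x : S × C}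
    (hφ : φ x = none) (hx : P.layer x.1 < H) {q : ℝ} (hq : ∀ π, P.visitProb π x.1 ≤ q)
    (L : Learner C S A) (a : A) (t : ℕ) (l : ℝ) :
    (1 - Real.exp (-l)) *
        ((banditCMDP P ε (Function.update φ x (some a))).actionLaw L t x.2 x.1 a).toReal ≤
      l * ((banditCMDP P ε φ).actionLaw L t x.2 x.1 a).toReal +
        ε ^ 2 * (q / Fintype.card C) * ∑ i ∈ Finset.range t,
          ((banditCMDP P ε φ).actionLaw L i x.2 x.1 a).toReal := by
  set E := banditCMDP P ε φ
  have hu := E.bddUnder_runLaw_sum (L := L) (F := fun e => stepSum (logRatio ε x a e.ctx) e.traj)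
    (fun c π τ => abs_stepSum_le (abs_logRatio_le hε x a c)) t
  have hchange := (CMDP.hasLogDensity_runLaw (E := E)
    (E' := banditCMDP P ε (Function.update φ x (some a))) (g := logRatio ε x a) rfl rfl
    (hasLogDensity_banditCMDP_reward hε hφ hx a) L t).mul_expect_le hu
    (f := fun h => (((L h x.2).bind fun π => π x.1) a).toReal)
    (fun h => ⟨ENNReal.toReal_nonneg, toReal_apply_le_one _ _⟩) l
  rw [← CMDP.toReal_actionLaw_apply, ← CMDP.toReal_actionLaw_apply] at hchange
  linarith [neg_expect_logRatio_le hε hφ hx hq L a t]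

variable [Fintype A]

lemma sum_actionLaw_update_le (hε : (ε : ℝ) ≤ 1 / 2) {φ : S × C → Option A} {x : S × C}
    (hφ : φ x = none) (hx : P.layer x.1 < H) {q : ℝ} (hq : ∀ π, P.visitProb π x.1 ≤ q)
    (L : Learner C S A) (t : ℕ) (l : ℝ) :
    (1 - Real.exp (-l)) * ∑ a,
        ((banditCMDP P ε (Function.update φ x (some a))).actionLaw L t x.2 x.1 a).toReal ≤
      l + ε ^ 2 * (q / Fintype.card C) * t := by
  have h := Finset.sum_le_sum fun a (_ : a ∈ Finset.univ) =>
    one_sub_exp_neg_mul_actionLaw_le hε hφ hx hq L a t l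
  simp only [Finset.sum_add_distrib, ← Finset.mul_sum] at h
  rw [Finset.sum_comm] at h
  simpa only [sum_toReal, mul_one, Finset.sum_const, Finset.card_range, nsmul_eq_mul] using h

end Information

end BanditInstance

section Averaging

lemma sum_sum_update {X A : Type*} [Fintype X] [DecidableEq X] [Fintype A] (x : X)
    (F : (X → A) → ℝ) :
    ∑ φ : X → A, ∑ a, F (Function.update φ x a) = Fintype.card A * ∑ φ, F φ := by
  let swap : (X → A) × A ≃ (X → A) × A :=
    Function.Involutive.toPerm (fun z => (Function.update z.1 x z.2, z.1 x)) fun z => by simp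
  calc ∑ φ : X → A, ∑ a, F (Function.update φ x a)
      = ∑ z, F (swap z).1 := (Fintype.sum_prod_type fun z => F (swap z).1).symm
    _ = ∑ z : (X → A) × A, F z.1 := Equiv.sum_comp swap fun z => F z.1
    _ = Fintype.card A * ∑ φ, F φ := by
      simp only [Fintype.sum_prod_type, Finset.sum_const, Finset.card_univ, nsmul_eq_mul,
        Finset.mul_sum]

lemma exists_mul_card_le_sum {Φ ι : Type*} [Fintype Φ] [Nonempty Φ] {J : Finset ι} {Y : Φ → ι → ℝ}
    {b : ℝ} (hY : ∀ j ∈ J, b * Fintype.card Φ ≤ ∑ φ, Y φ j) :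
    ∃ φ, b * J.card ≤ ∑ j ∈ J, Y φ j := by
  have hsum : ∑ _ : Φ, b * (J.card : ℝ) ≤ ∑ φ, ∑ j ∈ J, Y φ j := by
    rw [Finset.sum_comm, Finset.sum_const, Finset.card_univ, nsmul_eq_mul]
    refine le_of_eq_of_le ?_ (Finset.card_nsmul_le_sum J _ _ hY)
    rw [nsmul_eq_mul]
    ring
  obtain ⟨φ, -, hφ⟩ := Finset.exists_le_of_sum_le Finset.univ_nonempty hsum
  exact ⟨φ, hφ⟩

variable {C S A : Type*} {H : ℕ} [Fintype C] [Nonempty C] [Fintype A] [DecidableEq A]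
  {P : LayeredDynamics S A H} {ε : unitInterval}

lemma sum_actionLaw_best_le [DecidableEq C] [Fintype S] [DecidableEq S]
    (hA : 2 ≤ Fintype.card A) (hε : (ε : ℝ) ≤ 1 / 2) {s : S} (hs : P.layer s < H) {q : ℝ}
    (hq : ∀ π, P.visitProb π s ≤ q) (L : Learner C S A) {t : ℕ}
    (ht : ε ^ 2 * (q / Fintype.card C) * t ≤ (Fintype.card A : ℝ) / 40) (c : C) :
    ∑ φ : S × C → A, ((banditCMDP P ε (some ∘ φ)).actionLaw L t c s (φ (s, c))).toReal ≤
      3 / 4 * Fintype.card (S × C → A) := by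
  have hA' : (2 : ℝ) ≤ Fintype.card A := by exact_mod_cast hA
  have hresample (φ : S × C → A) :
      ∑ a, ((banditCMDP P ε (some ∘ Function.update φ (s, c) a)).actionLaw L t c s
        (Function.update φ (s, c) a (s, c))).toReal ≤ 3 / 4 * Fintype.card A := by
    have h := sum_actionLaw_update_le hε (P := P) (φ := Function.update (some ∘ φ) (s, c) none)
      (x := (s, c)) (Function.update_self ..) hs hq L t (Real.log 2)
    simp only [Function.update_idem, ← Function.comp_update, Real.exp_neg,
      Real.exp_log zero_lt_two] at h
    simp only [Function.update_self]
    -- `(1 - 1 / 2) * ∑ ≤ log 2 + |A| / 40 ≤ 3 / 8 * |A|`, as `2 ≤ |A|`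
    linarith [Real.log_two_lt_d9]
  have hsum := Finset.sum_le_sum fun φ (_ : φ ∈ Finset.univ) => hresample φ
  rw [sum_sum_update (s, c) fun φ : S × C → A =>
      ((banditCMDP P ε (some ∘ φ)).actionLaw L t c s (φ (s, c))).toReal,
    Finset.sum_const, Finset.card_univ, nsmul_eq_mul] at hsum
  refine le_of_mul_le_mul_left ?_ (zero_lt_two.trans_le hA')
  linarith

lemma exists_le_expectedRegret_banditCMDP [Finite S] (hA : 2 ≤ Fintype.card A)
    (hε : (ε : ℝ) ≤ 1 / 2) {I : Finset S} (hI : ∀ s ∈ I, P.layer s < H) {p q : ℝ} (hp₀ : 0 ≤ p)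
    (hp : ∀ π, ∀ s ∈ I, p ≤ P.visitProb π s) (hq : ∀ π, ∀ s ∈ I, P.visitProb π s ≤ q) (hq₀ : 0 ≤ q)
    (L : Learner C S A) {T : ℕ}
    (hT : ε ^ 2 * (q / Fintype.card C) * T ≤ (Fintype.card A : ℝ) / 40) :
    ∃ φ : S × C → A, ε * p * T * I.card / 8 ≤ (banditCMDP P ε (some ∘ φ)).expectedRegret L T := by
  classical
  have := Fintype.ofFinite S
  have : Nonempty A := Fintype.card_pos_iff.1 (by omega)
  obtain ⟨φ, hφ⟩ := exists_mul_card_le_sum (Φ := S × C → A) (b := 1 / 4)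
    (J := Finset.range T ×ˢ (Finset.univ : Finset C) ×ˢ I)
    (Y := fun φ j => 1 - ((banditCMDP P ε (some ∘ φ)).actionLaw L j.1 j.2.1 j.2.2
      (φ (j.2.2, j.2.1))).toReal) (by
    rintro ⟨t, c, s⟩ hj
    obtain ⟨ht, -, hs⟩ := by simpa only [Finset.mem_product, Finset.mem_range] using hj
    have htT : ε ^ 2 * (q / Fintype.card C) * t ≤ (Fintype.card A : ℝ) / 40 :=
      le_trans (by gcongr) hT
    rw [Finset.sum_sub_distrib, Finset.sum_const, Finset.card_univ, nsmul_eq_mul, mul_one]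
    linarith [sum_actionLaw_best_le hA hε (hI s hs) (fun π => hq π s hs) L htT c])
  refine ⟨φ, le_trans ?_ (le_banditCMDP_expectedRegret φ hI hp L T)⟩
  rw [← Finset.mul_sum, ← mul_assoc]
  simp only [Finset.sum_product, Finset.card_product, Finset.card_range, Finset.card_univ] at hφ
  refine le_trans (le_of_eq ?_) (mul_le_mul_of_nonneg_left hφ
    (mul_nonneg (mul_nonneg (div_nonneg ε.2.1 zero_le_two) hp₀) (inv_nonneg.2 (Nat.cast_nonneg _))))
  push_cast
  field_simp
  ring

end Averaging

section Layering

/-- A partition of `S` into nonempty layers `0, …, H`, of which the first and the last one are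
singletons. -/
structure Layering (S : Type*) (H : ℕ) where
  layer : S → ℕ
  start : S
  final : S
  layer_le : ∀ s, layer s ≤ H
  layer_eq_zero_iff : ∀ s, layer s = 0 ↔ s = start
  layer_eq_horizon_iff : ∀ s, layer s = H ↔ s = final
  exists_layer_eq : ∀ l ≤ H, ∃ s, layer s = l

lemma bind_eq_of_forall_mem_support {X Y : Type*} {p : PMF X} {k : X → PMF Y} {q : PMF Y}
    (h : ∀ x ∈ p.support, k x = q) : p.bind k = q := by
  rw [← PMF.bind_const p q]
  ext y
  rw [PMF.bind_apply, PMF.bind_apply]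
  refine tsum_congr fun x => ?_
  by_cases hx : p x = 0
  · rw [hx, zero_mul, zero_mul]
  · rw [h x hx]

namespace Layering

variable {S A : Type*} [Fintype S] {H : ℕ} (Λ : Layering S H)

/-- The set of the states in the layer `l`. -/
def cell (l : ℕ) : Finset S := {s | Λ.layer s = l}

lemma mem_cell {l : ℕ} {s : S} : s ∈ Λ.cell l ↔ Λ.layer s = l :=
  Finset.mem_filter_univ s

lemma cell_nonempty {l : ℕ} (hl : l ≤ H) : (Λ.cell l).Nonempty :=
  (Λ.exists_layer_eq l hl).imp fun _ => Λ.mem_cell.2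

lemma cell_zero : Λ.cell 0 = {Λ.start} := by
  ext s
  rw [mem_cell, Λ.layer_eq_zero_iff, Finset.mem_singleton]

/-- The uniform law on the layer `l`, or on the last layer if `H < l`. -/
def layerLaw (l : ℕ) : PMF S :=
  PMF.uniformOfFinset (Λ.cell (min l H)) (Λ.cell_nonempty (min_le_right l H))

lemma mem_support_layerLaw {l : ℕ} (hl : l ≤ H) {s : S} :
    s ∈ (Λ.layerLaw l).support ↔ Λ.layer s = l := by
  rw [layerLaw, PMF.mem_support_uniformOfFinset_iff, min_eq_left hl, mem_cell]

lemma layerLaw_layer_apply (s : S) :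
    Λ.layerLaw (Λ.layer s) s = ((Λ.cell (Λ.layer s)).card : ENNReal)⁻¹ := by
  have hs : s ∈ Λ.cell (min (Λ.layer s) H) := by rw [min_eq_left (Λ.layer_le s), mem_cell]
  rw [layerLaw, PMF.uniformOfFinset_apply_of_mem _ hs, min_eq_left (Λ.layer_le s)]

lemma layerLaw_zero : Λ.layerLaw 0 = PMF.pure Λ.start := by
  ext s
  simp only [layerLaw, Nat.zero_min, cell_zero, PMF.uniformOfFinset_apply, Finset.mem_singleton,
    Finset.card_singleton, Nat.cast_one, inv_one, PMF.pure_apply]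
  congr 1
  exact propext Finset.mem_singleton

/-- The dynamics that moves from each layer to a uniform state of the next one. -/
def unifDynamics (A : Type*) : LayeredDynamics S A H where
  trans s _ := Λ.layerLaw (Λ.layer s + 1)
  start := Λ.start
  final := Λ.final
  layer := Λ.layer
  layer_le := Λ.layer_le
  layer_eq_zero_iff := Λ.layer_eq_zero_iff
  layer_eq_horizon_iff := Λ.layer_eq_horizon_iff
  layer_succ s _ _ hs :=
    (Λ.mem_support_layerLaw <|
      (Λ.layer_le s).lt_of_ne fun h => hs ((Λ.layer_eq_horizon_iff s).1 h)).1

lemma stateLaw_unifDynamics (π : Policy S A) {l : ℕ} (hl : l ≤ H) :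
    stateLaw (Λ.unifDynamics A).trans π Λ.start l = Λ.layerLaw l := by
  induction l with
  | zero => rw [stateLaw, layerLaw_zero]
  | succ l ih =>
    have hstep (s : S) (hs : s ∈ (Λ.layerLaw l).support) :
        ((π s).bind fun a => (Λ.unifDynamics A).trans s a) = Λ.layerLaw (l + 1) := by
      rw [← (Λ.mem_support_layerLaw (by omega)).1 hs]
      exact PMF.bind_const _ _
    rw [stateLaw, ih (by omega), bind_eq_of_forall_mem_support hstep]

lemma visitProb_unifDynamics (π : Policy S A) (s : S) :
    (Λ.unifDynamics A).visitProb π s = ((Λ.cell (Λ.layer s)).card : ℝ)⁻¹ := by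
  have h := Λ.stateLaw_unifDynamics π (Λ.layer_le s)
  rw [LayeredDynamics.visitProb]
  change (stateLaw _ π Λ.start (Λ.layer s) s).toReal = _
  rw [h, layerLaw_layer_apply, ENNReal.toReal_inv, ENNReal.toReal_natCast]

lemma minReachable_unifDynamics (A : Type*) :
    (Λ.unifDynamics A).MinReachable (Fintype.card S : ℝ)⁻¹ := fun π s => by
  change _ ≤ (Λ.unifDynamics A).visitProb π s
  have hcell : 0 < (Λ.cell (Λ.layer s)).card :=
    Finset.card_pos.2 (Λ.cell_nonempty (Λ.layer_le s))
  rw [visitProb_unifDynamics]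
  gcongr
  exact Finset.card_le_univ _

/-- The states of the layers other than the first and the last one. -/
def inner : Finset S := {s | 0 < Λ.layer s ∧ Λ.layer s < H}

lemma card_inner_add_two (hH : 0 < H) : Λ.inner.card + 2 = Fintype.card S := by
  classical
  have hne : Λ.start ≠ Λ.final := fun h =>
    hH.ne (((Λ.layer_eq_zero_iff _).2 h.symm).symm.trans ((Λ.layer_eq_horizon_iff _).2 rfl))
  have hcompl : Λ.innerᶜ = {Λ.start, Λ.final} := by
    ext s
    have hle := Λ.layer_le s
    rw [Finset.mem_insert, Finset.mem_singleton, ← Λ.layer_eq_zero_iff, ← Λ.layer_eq_horizon_iff,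
      Finset.mem_compl, inner, Finset.mem_filter_univ]
    omega
  rw [← Finset.card_pair hne, ← hcompl, Finset.card_add_card_compl]

end Layering

/-- The layers of a grid with `n` columns of `M` states, a start state `none` on its left and a
final state `some none` on its right. -/
def gridLayer {n M : ℕ} : Option (Option (Fin n × Fin M)) → ℕ
  | none => 0
  | some none => n + 1
  | some (some x) => x.1 + 1

lemma card_gridLayer_eq {n M l : ℕ} (hl₀ : 0 < l) (hl : l ≤ n) :
    (Finset.univ.filter fun x : Option (Option (Fin n × Fin M)) => gridLayer x = l).card = M := by
  have hcol (i : Fin n) : (i : ℕ) + 1 = l ↔ i = ⟨l - 1, by omega⟩ := by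
    rw [Fin.ext_iff]
    dsimp only
    omega
  have hlast : n + 1 ≠ l := by omega
  rw [Finset.card_filter, Fintype.sum_option, Fintype.sum_option, Fintype.sum_prod_type]
  simp [gridLayer, hcol, hl₀.ne, hlast]

lemma exists_layering_card_cell_eq {S : Type*} [Fintype S] {n M : ℕ} (hM : 0 < M)
    (hS : Fintype.card S = M * n + 2) :
    ∃ Λ : Layering S (n + 1), ∀ l, 0 < l → l ≤ n → (Λ.cell l).card = M := by
  have e : S ≃ Option (Option (Fin n × Fin M)) := Fintype.equivOfCardEq (by simp [hS, mul_comm])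
  have hcard (l : ℕ) (hl₀ : 0 < l) (hl : l ≤ n) :
      (Finset.univ.filter fun s => gridLayer (e s) = l).card = M := by
    refine Eq.trans ?_ (card_gridLayer_eq hl₀ hl)
    rw [Finset.card_filter, Finset.card_filter]
    exact e.sum_comp fun x => if gridLayer x = l then 1 else 0
  refine ⟨⟨fun s => gridLayer (e s), e.symm none, e.symm (some none), fun s => ?_, fun s => ?_,
    fun s => ?_, fun l hl => ?_⟩, hcard⟩
  · rcases e s with _ | _ | ⟨i, j⟩ <;> simp only [gridLayer] <;> omega
  · rw [Equiv.eq_symm_apply]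
    rcases e s with _ | _ | ⟨i, j⟩ <;> simp [gridLayer]
  · rw [Equiv.eq_symm_apply]
    rcases e s with _ | _ | ⟨i, j⟩
    · simp [gridLayer]
    · simp [gridLayer]
    · simp [gridLayer, i.is_lt.ne]
  · obtain rfl | hl₀ := Nat.eq_zero_or_pos l
    · exact ⟨e.symm none, by simp [gridLayer]⟩
    obtain rfl | hl := hl.eq_or_lt
    · exact ⟨e.symm (some none), by simp [gridLayer]⟩
    obtain ⟨s, hs⟩ := Finset.card_pos.1 (hM.trans_eq (hcard l hl₀ (by omega)).symm)
    exact ⟨s, (Finset.mem_filter_univ s).1 hs⟩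

end Layering

section Rate

/-- The largest gap, up to a constant, that `T` episodes do not reveal when they are spread over
`n` bandit problems with `k` actions each. -/
def gapSize (k n T : ℝ) : unitInterval :=
  ⟨min (1 / 2) (√(k * n / T) / 8), by positivity, (min_le_left _ _).trans (by norm_num)⟩

lemma gapSize_le_half (k n T : ℝ) : (gapSize k n T : ℝ) ≤ 1 / 2 := min_le_left _ _

lemma sq_gapSize_mul_le {k n T : ℝ} (hk : 0 ≤ k) (hn : 0 < n) (hT : 0 ≤ T) :
    (gapSize k n T : ℝ) ^ 2 * n⁻¹ * T ≤ k / 40 := by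
  obtain rfl | hT := hT.eq_or_lt
  · rw [mul_zero]
    positivity
  calc (gapSize k n T : ℝ) ^ 2 * n⁻¹ * T ≤ (√(k * n / T) / 8) ^ 2 * n⁻¹ * T := by
        gcongr
        exacts [(gapSize k n T).2.1, min_le_right _ _]
    _ = k / 64 := by
        rw [div_pow, Real.sq_sqrt (by positivity)]
        field_simp
        norm_num
    _ ≤ k / 40 := by linarith

lemma min_sqrt_le_gapSize_mul (k n : ℝ) {T : ℝ} (hT : 0 ≤ T) :
    min (√(k * n * T)) T ≤ 8 * (gapSize k n T * T) := by
  obtain rfl | hT := hT.eq_or_lt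
  · simp
  have hsqrt : √(k * n * T) = √(k * n / T) * T := by
    rw [show k * n * T = k * n / T * T ^ 2 by field_simp, Real.sqrt_mul' _ (sq_nonneg T),
      Real.sqrt_sq hT.le]
  change _ ≤ 8 * (min (1 / 2) (√(k * n / T) / 8) * T)
  rw [hsqrt, min_mul_of_nonneg _ _ hT.le, mul_min_of_nonneg _ _ (by norm_num)]
  refine le_min ?_ ?_
  · linarith [min_le_right (√(k * n / T) * T) T]
  · linarith [min_le_left (√(k * n / T) * T) T]

lemma sqrt_mul_le_mul_sqrt {k T H S x M K : ℝ} (hk : 0 ≤ k) (hT : 0 ≤ T) (hH : 2 ≤ H)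
    (hM : 1 ≤ M) (hS : S = M * (H - 1) + 2) (hx₀ : 0 ≤ x) (hx : x ≤ 2 * K) :
    √(T * H * S * k * x) ≤ 4 * (H - 1) * √(k * (M * K) * T) := by
  have hH' : 0 ≤ H - 1 := by linarith
  have hK : 0 ≤ K := by linarith
  have : 0 ≤ M := by linarith
  have hS' : S ≤ 3 * (M * (H - 1)) := by nlinarith
  refine Real.sqrt_le_iff.2 ⟨by positivity, ?_⟩
  rw [mul_pow, Real.sq_sqrt (by positivity)]
  calc T * H * S * k * x
      ≤ T * (2 * (H - 1)) * (3 * (M * (H - 1))) * k * (2 * K) := by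
        gcongr <;> linarith
    _ = 12 * ((H - 1) ^ 2 * (k * (M * K) * T)) := by ring
    _ ≤ 16 * ((H - 1) ^ 2 * (k * (M * K) * T)) := by gcongr; norm_num
    _ = (4 * (H - 1)) ^ 2 * (k * (M * K) * T) := by ring

lemma min_sqrt_le_gapSize_mul_horizon {k T H S x M K : ℝ} (hk : 0 ≤ k) (hT : 0 ≤ T) (hH : 2 ≤ H)
    (hM : 1 ≤ M) (hS : S = M * (H - 1) + 2) (hx₀ : 0 ≤ x) (hx : x ≤ 2 * K) :
    min (√(T * H * S * k * x)) (T * H) ≤ 32 * (gapSize k (M * K) T * T * (H - 1)) := by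
  have hH' : 0 ≤ 4 * (H - 1) := by linarith
  calc min (√(T * H * S * k * x)) (T * H)
      ≤ min (4 * (H - 1) * √(k * (M * K) * T)) (4 * (H - 1) * T) :=
        min_le_min (sqrt_mul_le_mul_sqrt hk hT hH hM hS hx₀ hx) (by nlinarith)
    _ = 4 * (H - 1) * min (√(k * (M * K) * T)) T := (mul_min_of_nonneg _ _ hH').symm
    _ ≤ 4 * (H - 1) * (8 * (gapSize k (M * K) T * T)) :=
        mul_le_mul_of_nonneg_left (min_sqrt_le_gapSize_mul k (M * K) hT) hH'
    _ = 32 * (gapSize k (M * K) T * T * (H - 1)) := by ring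

lemma log_div_log_le_two_mul_natLog {a N : ℕ} (ha : 2 ≤ a) (hN : a ≤ N) :
    Real.log N / Real.log a ≤ 2 * Nat.log a N := by
  have hK : 1 ≤ Nat.log a N := Nat.log_pos (by omega) hN
  have hfloor : ⌊Real.logb a N⌋₊ = Nat.log a N := Real.natFloor_logb_natCast a N
  have hlt : Real.logb a N < ⌊Real.logb a N⌋₊ + 1 := Nat.lt_floor_add_one _
  have hK' : (1 : ℝ) ≤ Nat.log a N := by exact_mod_cast hK
  rw [hfloor] at hlt
  rw [Real.log_div_log]
  linarith

end Rate

section UnifDynamics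

variable {C S A : Type*} [Fintype C] [Nonempty C] [Fintype S] [Fintype A] [DecidableEq A] {n M : ℕ}

lemma exists_le_expectedRegret_banditCMDP_unifDynamics (hA : 2 ≤ Fintype.card A) (hM : 0 < M)
    (Λ : Layering S (n + 1)) (hΛ : ∀ l, 0 < l → l ≤ n → (Λ.cell l).card = M)
    (hS : Fintype.card S = M * n + 2) (L : Learner C S A) (T : ℕ) :
    ∃ φ : S × C → A,
      (gapSize (Fintype.card A) (M * Fintype.card C) T : ℝ) * T * n / 8 ≤
        (banditCMDP (Λ.unifDynamics A) (gapSize (Fintype.card A) (M * Fintype.card C) T)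
          (some ∘ φ)).expectedRegret L T := by
  have hM' : (M : ℝ) ≠ 0 := by exact_mod_cast hM.ne'
  have hinner : Λ.inner.card = M * n := by
    have := Λ.card_inner_add_two n.succ_pos
    omega
  have hvisit (π : Policy S A) (s : S) (hs : s ∈ Λ.inner) :
      (Λ.unifDynamics A).visitProb π s = (M : ℝ)⁻¹ := by
    obtain ⟨hpos, hlt⟩ := (Finset.mem_filter_univ s).1 hs
    rw [Λ.visitProb_unifDynamics, hΛ _ hpos (by omega)]
  obtain ⟨φ, hφ⟩ := exists_le_expectedRegret_banditCMDP hA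
    (gapSize_le_half (Fintype.card A) (M * Fintype.card C) T)
    (fun s hs => ((Finset.mem_filter_univ s).1 hs).2) (inv_nonneg.2 (Nat.cast_nonneg M))
    (fun π s hs => (hvisit π s hs).ge) (fun π s hs => (hvisit π s hs).le)
    (inv_nonneg.2 (Nat.cast_nonneg M)) L (T := T) (by
      rw [div_eq_mul_inv, ← mul_inv]
      exact sq_gapSize_mul_le (Nat.cast_nonneg _) (by positivity) (Nat.cast_nonneg T))
  refine ⟨φ, le_of_eq_of_le ?_ hφ⟩
  rw [hinner]
  push_cast
  field_simp

end UnifDynamics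

end

end CtxMDP

open CtxMDP in
theorem mainTheorem4_general :
    ∃ κ : ℝ, 0 < κ ∧
      ∀ (S A : Type*) [Fintype S] [Fintype A] (H M N T : ℕ),
        2 ≤ H → 1 ≤ M → 2 ≤ Fintype.card A → Fintype.card A ≤ N →
        Fintype.card S = M * (H - 1) + 2 →
        ∃ (d : ℕ) (C : Finset (EuclideanSpace ℝ (Fin d))) (P : LayeredDynamics S A H),
          (∃ p : ℝ, 0 < p ∧ P.MinReachable p) ∧
          ∃ G : Finset (C → A → unitInterval), G.card ≤ N ∧
            ∀ L : Learner C S A,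
              ∃ E : CMDP C S A H,
                (∀ c, E.dyn c = P) ∧
                E.Realizable G ∧
                κ * min
                    (Real.sqrt ((T : ℝ) * H * Fintype.card S * Fintype.card A
                      * (Real.log (N : ℝ) / Real.log (Fintype.card A : ℝ))))
                    ((T : ℝ) * H)
                  ≤ E.expectedRegret L T := by
  classical
  refine ⟨1 / 256, by norm_num, fun S A _ _ H M N T hH hM hA hN hS => ?_⟩
  obtain ⟨n, rfl⟩ : ∃ n, H = n + 1 := ⟨H - 1, by omega⟩
  rw [Nat.add_sub_cancel] at hS
  obtain ⟨Λ, hΛ⟩ := exists_layering_card_cell_eq hM hS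
  obtain ⟨C, hC⟩ := Infinite.exists_subset_card_eq (EuclideanSpace ℝ (Fin 1))
    (Nat.log (Fintype.card A) N)
  have hCcard : Fintype.card C = Nat.log (Fintype.card A) N := by rw [Fintype.card_coe, hC]
  have : Nonempty C := Fintype.card_pos_iff.1 (hCcard ▸ Nat.log_pos (by omega) hN)
  let ε := gapSize (Fintype.card A) (M * Fintype.card C) T
  refine ⟨1, C, Λ.unifDynamics A,
    ⟨_, inv_pos.2 (by rw [hS]; positivity), Λ.minReachable_unifDynamics A⟩, banditClass C A ε,
    card_banditClass_le.trans (hCcard ▸ Nat.pow_log_le_self _ (by omega)), fun L => ?_⟩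
  obtain ⟨φ, hφ⟩ := exists_le_expectedRegret_banditCMDP_unifDynamics hA hM Λ hΛ hS L T
  refine ⟨_, fun _ => rfl, banditCMDP_realizable φ, le_trans ?_ hφ⟩
  have hrate := min_sqrt_le_gapSize_mul_horizon (Nat.cast_nonneg (Fintype.card A))
    (Nat.cast_nonneg T) (by exact_mod_cast hH : (2 : ℝ) ≤ (n + 1 : ℕ)) (Nat.one_le_cast.2 hM)
    (S := Fintype.card S) (by rw [hS]; push_cast; ring) (by positivity)
    (log_div_log_le_two_mul_natLog hA hN)
  rw [← hCcard, Nat.cast_succ n, add_sub_cancel_right, ← Nat.cast_succ] at hrate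
  linarith

theorem mainTheorem4 :
    ∃ κ : ℝ, 0 < κ ∧
      ∀ (S A : Type*) [Fintype S] [Fintype A] (H M N T : ℕ) (δ : ℝ),
        2 ≤ H → 1 ≤ M → 2 ≤ Fintype.card A → Fintype.card A ≤ N →
        0 < δ → δ < 1 →
        Fintype.card S = M * (H - 1) + 2 →
        8 * (M : ℝ) * Real.log ((Fintype.card S : ℝ) / δ)
            + 2 * (M : ℝ) * (Real.log (N : ℝ) / Real.log (Fintype.card A : ℝ)) ≤ (T : ℝ) →
        ∃ (d : ℕ) (C : Finset (EuclideanSpace ℝ (Fin d))) (P : CtxMDP.LayeredDynamics S A H),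
          (∃ p : ℝ, 0 < p ∧ P.MinReachable p) ∧
          ∀ L : Finset (C → A → unitInterval) → CtxMDP.Learner C S A,
            ∃ G : Finset (C → A → unitInterval), G.card ≤ N ∧
              ∃ E : CtxMDP.CMDP C S A H,
                (∀ c, E.dyn c = P) ∧
                E.Realizable G ∧
                κ * min
                    (Real.sqrt ((T : ℝ) * H * Fintype.card S * Fintype.card A
                      * (Real.log (N : ℝ) / Real.log (Fintype.card A : ℝ))))
                    ((T : ℝ) * H)
                  ≤ E.expectedRegret (L G) T :=
  mainTheorem4_general.imp fun _ ⟨hκ, h⟩ => ⟨hκ, fun S A _ _ H M N T _ hH hM hA hN _ _ hS _ =>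
    let ⟨d, C, P, hP, G, hG, hE⟩ := h S A H M N T hH hM hA hN hS
    ⟨d, C, P, hP, fun L => ⟨G, hG, hE (L G)⟩⟩⟩
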